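/- Let $B_1,\dots,B_d$ be smooth ($C^\infty$) functions on $\mathbb R^d$ with values in $N\times N$ matrices (real or complex), and put $D_\mu f=\partial_\mu f+B_\mu f$, $\nabla_\mu f=\partial_\mu f+[B_\mu,f]$, $A_1=-\sum_\mu D_\mu D_\mu$ and $F_{\nu\mu}=\partial_\nu B_\mu-\partial_\mu B_\nu+[B_\nu,B_\mu]$. Let the matrix-valued functions $a_n(x,y)$, $n\ge 0$, be the Seeley–DeWitt coefficients of $A_1$, that is, the solutions, smooth in $x$, of $$\sum_\mu (x-y)^\mu D_{x^\mu}a_0(x,y)=0,\qquad a_0(y,y)=1,$$ $$\Bigl((n+1)+\sum_\mu (x-y)^\mu D_{x^\mu}\Bigr)a_{n+1}(x,y)=-A_1a_n(x,y)\quad(n\ge 0).$$ Consider two-row matrices with finitely many columns, whose upper elements are multi-indices with values in $\{1,\dots,d\}$ or the symbol $\mathbf 1$, whose lower elements are natural numbers, and their formal linear combinations; $\mathbb 1$ is the matrix without columns. The operator $S_l^{\mu_1\cdots\mu_m}$ adds the column $\binom{\mu_1\cdots\mu_m}{l}$ on the left. The linear operator $\Upsilon$ (at the point $x$) replaces each multi-index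 $\mu_1\cdots\mu_m$ by $\nabla_{\mu_1}\cdots\nabla_{\mu_{m-1}}\bigl(\sum_\rho (z-y)^\rho F_{\rho\mu_m}(z)\bigr)\big|_{z=y=x}$ and $\mathbf 1$ by the unit matrix, multiplies the results in the order of the columns, and divides by the product of the lower elements; $\Upsilon\mathbb 1=1$. For a finite set $J$ of positive integers, $\mu_J$ denotes the multi-index of the $\mu_j$, $j\in J$, written from left to right in decreasing order of $j$, and $$\Sigma_l^{\mu_J}=\sum_{(\sigma_1,\dots,\sigma_k)} S^{\mu_{\sigma_k}}_{l+\#(\sigma_1\cup\dots\cup\sigma_k)}\cdots S^{\mu_{\sigma_2}}_{l+\#(\sigma_1\cup\sigma_2)}S^{\mu_{\sigma_1}}_{l+\#\sigma_1},$$ the sum being over all ordered partitions of $J$ into non-empty blocks (for $J=\varnothing$ it is the identity). Put $\widehat S_l^{\mu_J}=\Upsilon S_l^{\mu_J}\mathbb 1$ and $\widehat\Sigma_l^{\mu_J}=\Upsilon\Sigma_l^{\mu_J}\mathbb 1$. Write $I_m=\{m,\dots,1\}$. Then for every $x\in\mathbb R^d$ and every $n\ge 1$, with summation over all $\mu_1,\dots,\mu_{2n}\in\{1,\dots,d\}$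 such that $\mu_{2k-1}=\mu_{2k}$ for all $k\in\{1,\dots,n\}$, $$a_n(x,x)=\sum_{\mu}\ \sum_{p_1=0}^{2}\ \sum_{p_2=0}^{4-p_1}\cdots\sum_{p_{n-1}=0}^{2(n-1)-\sum_{k=1}^{n-2}p_k}\ \sum_{\sigma}\ \left(\prod_{k=1}^{n-1}\frac{\widehat\Sigma^{\mu_{\sigma_{p_k}}}_{\,n+k-\sum_{j=1}^{k}p_j}}{n+k-\sum_{j=1}^{k}p_j}\right)\frac{\widehat\Sigma_0^{\mu_{I_{2n}\setminus\bigcup_{s=1}^{n-1}\sigma_{p_s}}}}{n},$$ where the product is taken from left to right in increasing order of $k$ and $\sigma$ runs over all families of subsets $\sigma_{p_k}\subset (I_{2n}\setminus I_{2(n-k)})\setminus\bigcup_{j=1}^{k-1}\sigma_{p_j}$ with $\#\sigma_{p_k}=p_k$, $k=1,\dots,n-1$. Moreover, for all natural numbers $l$, $$\widehat\Sigma_l^{\mu_J}=\sum_{(\sigma_1,\dots,\sigma_k)}\widehat S^{\mu_{\sigma_k}}_{l+\#(\sigma_1\cup\dots\cup\sigma_k)}\cdots\widehat S^{\mu_{\sigma_2}}_{l+\#(\sigma_1\cup\sigma_2)}\widehat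 S^{\mu_{\sigma_1}}_{l+\#\sigma_1}$$ with the same summation over ordered partitions, and for all $l\ge 1$, $m\ge 0$ and all indices $\mu_m,\dots,\mu_1,\nu$, $$\widehat S_l^{\mu_m\cdots\mu_1\nu}=\frac1l\sum_{k=1}^{m}\nabla_{\mu_{I_m\setminus k}}F_{\mu_k\nu}(x),\qquad \nabla_{\mu_m\cdots\mu_1}=\nabla_{\mu_m}\cdots\nabla_{\mu_1}.$$ -/

import Mathlib

open scoped ContDiff

/- Smoothness of matrix-valued functions refers to the (finite-dimensional, hence norm-independent)
topology of matrices; this fixes one submultiplicative norm. -/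
attribute [local instance] Matrix.linftyOpNormedRing Matrix.linftyOpNormedAlgebra

noncomputable section

namespace HeatDiag

/-- Flat space `ℝ^d`. -/
abbrev E (d : ℕ) : Type := EuclideanSpace ℝ (Fin d)

section Covariant

variable {R : Type*} [NormedRing R] [NormedAlgebra ℝ R] {d : ℕ}

/-- The partial derivative `∂_μ f (x)`. -/
def pd (μ : Fin d) (f : E d → R) (x : E d) : R :=
  fderiv ℝ f x (EuclideanSpace.single μ (1 : ℝ))

/-- The covariant derivative `D_μ f = ∂_μ f + B_μ f`. -/
def covD (B : Fin d → E d → R) (μ : Fin d) (f : E d → R) (x : E d) : R :=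
  pd μ f x + B μ x * f x

/-- The covariant Laplace operator `A₁ f = - D_μ D_μ f` (summed over `μ`). -/
def A₁ (B : Fin d → E d → R) (f : E d → R) (x : E d) : R :=
  - ∑ μ : Fin d, covD B μ (covD B μ f) x

/-- The operator `(x - y)^μ D_μ` (summed over `μ`). -/
def radialD (B : Fin d → E d → R) (y : E d) (f : E d → R) (x : E d) : R :=
  ∑ μ : Fin d, (x μ - y μ) • covD B μ f x

/-- The derivative in the adjoint representation, `∇_μ f = ∂_μ f + [B_μ, f]`. -/
def nabla (B : Fin d → E d → R) (μ : Fin d) (f : E d → R) (x : E d) : R :=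
  pd μ f x + (B μ x * f x - f x * B μ x)

/-- `∇_{μ_1} ∇_{μ_2} ⋯ ∇_{μ_m} f` for the multi-index `[μ_1, …, μ_m]`. -/
def nablas (B : Fin d → E d → R) (L : List (Fin d)) (f : E d → R) : E d → R :=
  L.foldr (nabla B) f

/-- The field strength `F_{νμ} = ∂_ν B_μ - ∂_μ B_ν + [B_ν, B_μ]`. -/
def fieldStrength (B : Fin d → E d → R) (ν μ : Fin d) (x : E d) : R :=
  pd ν (B μ) x - pd μ (B ν) x + (B ν x * B μ x - B μ x * B ν x)

/-- `a n x y = a_n(x, y)` are the Seeley–DeWitt coefficients of the covariant Laplace operator: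
the smooth solutions of the recursive system obtained from the heat equation for
`(4πτ)^{-d/2} exp(-|x-y|²/(4τ)) ∑ τ^n a_n(x, y)`, normalised by `a_0(y, y) = 1`. -/
structure IsSeeleyDeWitt (B : Fin d → E d → R) (a : ℕ → E d → E d → R) : Prop where
  smooth : ∀ (n : ℕ) (y : E d), ContDiff ℝ ∞ (fun x => a n x y)
  diag : ∀ y : E d, a 0 y y = 1
  zero : ∀ x y : E d, radialD B y (fun z => a 0 z y) x = 0
  succ : ∀ (n : ℕ) (x y : E d),
    ((n : ℝ) + 1) • a (n + 1) x y + radialD B y (fun z => a (n + 1) z y) x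
      = - A₁ B (fun z => a n z y) x

end Covariant

section Matrices

/-- A two-row matrix of the diagram formalism, as the list of its columns. The first entry of a
column is the upper element: a non-empty multi-index for a circle, the empty list for the
element `𝟏` (a cross). The second entry is the lower element. -/
abbrev DMat (d : ℕ) : Type := List (List (Fin d) × ℕ)

/-- Formal linear combinations of such matrices. -/
abbrev DSpace (d : ℕ) : Type := DMat d →₀ ℝ

/-- The matrix `𝟙` without columns. -/
def emptyMat (d : ℕ) : DSpace d := Finsupp.single [] 1

/-- The integration operator `S_l^L`: it adds the column with entries `L` and `l` on the left. -/
def S {d : ℕ} (L : List (Fin d)) (l : ℕ) : Module.End ℝ (DSpace d) :=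
  Finsupp.lmapDomain ℝ ℝ (List.cons (L, l))

/-- The multi-index `μ_J`: the `μ_j`, `j ∈ J`, written from left to right in decreasing order
of `j`. -/
def multi {d m : ℕ} (μ : Fin m → Fin d) (J : Finset (Fin m)) : List (Fin d) :=
  ((J.sort (· ≤ ·)).reverse).map μ

/-- The ordered partitions `(σ_1, …, σ_k)` of `J` into `k` non-empty blocks (the block `σ_{i+1}`
is `σ i`). -/
def orderedPartitions {m : ℕ} (J : Finset (Fin m)) (k : ℕ) : Finset (Fin k → Finset (Fin m)) :=
  Finset.univ.filter fun σ =>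
    (∀ i, (σ i).Nonempty) ∧ (∀ i j, i ≠ j → Disjoint (σ i) (σ j)) ∧ Finset.univ.biUnion σ = J

/-- The number `#(σ_1 ∪ ⋯ ∪ σ_{i+1})`. -/
def cumCard {m k : ℕ} (σ : Fin k → Finset (Fin m)) (i : Fin k) : ℕ :=
  ((Finset.Iic i).biUnion σ).card

/-- The operator series `Σ_l^{μ_J}`, the sum over all ordered partitions of `J` of
`S_{l+#(σ_1∪⋯∪σ_k)}^{μ_{σ_k}} ⋯ S_{l+#(σ_1∪σ_2)}^{μ_{σ_2}} S_{l+#σ_1}^{μ_{σ_1}}`. -/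
def SigmaOp {d m : ℕ} (l : ℕ) (μ : Fin m → Fin d) (J : Finset (Fin m)) :
    Module.End ℝ (DSpace d) :=
  ∑ k ∈ Finset.range (J.card + 1), ∑ σ ∈ orderedPartitions J k,
    ((List.ofFn fun i : Fin k => S (multi μ (σ i)) (l + cumCard σ i)).reverse).prod

variable {R : Type*} [NormedRing R] [NormedAlgebra ℝ R] {d : ℕ}

/-- The function of `z` that an upper element stands for:
`∇_{μ_1} ⋯ ∇_{μ_{n-1}} ((z - y)^ρ F_{ρ μ_n}(z))` for the multi-index `[μ_1, …, μ_n]`, and `1`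
for a cross. -/
def vertex (B : Fin d → E d → R) (y : E d) : List (Fin d) → E d → R
  | [] => fun _ => 1
  | [ν] => fun z => ∑ ρ : Fin d, (z ρ - y ρ) • fieldStrength B ρ ν z
  | μ :: ν :: L => nabla B μ (vertex B y (ν :: L))

/-- The evaluation operator `Υ` at `z = y = x`: the product, from left to right, of the upper
elements, divided by the product of the lower elements; extended linearly. -/
def Upsilon (B : Fin d → E d → R) (x : E d) : DSpace d →ₗ[ℝ] R :=
  Finsupp.linearCombination ℝ fun M : DMat d =>
    ((M.map fun c => (c.2 : ℝ)).prod)⁻¹ • (M.map fun c => vertex B x c.1 x).prod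

/-- `Ŝ_l^L = Υ S_l^L 𝟙`. -/
def Shat (B : Fin d → E d → R) (x : E d) (L : List (Fin d)) (l : ℕ) : R :=
  Upsilon B x (S L l (emptyMat d))

/-- `Σ̂_l^{μ_J} = Υ Σ_l^{μ_J} 𝟙`. -/
def SigmaHat (B : Fin d → E d → R) (x : E d) {m : ℕ} (l : ℕ) (μ : Fin m → Fin d)
    (J : Finset (Fin m)) : R :=
  Upsilon B x (SigmaOp l μ J (emptyMat d))

end Matrices

section Sums

/-- The range of the summation over `p_1, …, p_{n-1}` (`p_{k+1}` is `p k`):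
`0 ≤ p_k ≤ 2k - (p_1 + ⋯ + p_{k-1})`. -/
def pRange (n : ℕ) : Finset (Fin (n - 1) → ℕ) :=
  (Fintype.piFinset fun k : Fin (n - 1) => Finset.range (2 * ((k : ℕ) + 1) + 1)).filter fun p =>
    ∀ k, (∑ j ∈ Finset.Iio k, p j) + p k ≤ 2 * ((k : ℕ) + 1)

/-- The range of the summation over `σ_{p_1}, …, σ_{p_{n-1}}` (`σ_{p_{k+1}}` is `σ k`, and the
index `i + 1` of `I_{2n} = {2n, …, 1}` is `i : Fin (2 * n)`): `#σ_{p_k} = p_k` and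
`σ_{p_k} ⊆ (I_{2n} ∖ I_{2(n-k)}) ∖ (σ_{p_1} ∪ ⋯ ∪ σ_{p_{k-1}})`. -/
def sigmaRange (n : ℕ) (p : Fin (n - 1) → ℕ) : Finset (Fin (n - 1) → Finset (Fin (2 * n))) :=
  Finset.univ.filter fun σ => ∀ k,
    (σ k).card = p k ∧
    σ k ⊆ (Finset.univ.filter fun i : Fin (2 * n) => 2 * (n - ((k : ℕ) + 1)) ≤ (i : ℕ)) \
      (Finset.Iio k).biUnion σ

/-- The weight `n + k - (p_1 + ⋯ + p_k)`, with `k + 1` in place of `k`; on `pRange n` it is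
positive and the subtraction is not truncated. -/
def weight (n : ℕ) (p : Fin (n - 1) → ℕ) (k : Fin (n - 1)) : ℕ :=
  n + ((k : ℕ) + 1) - ∑ j ∈ Finset.Iic k, p j

/-- The indices `μ_1, …, μ_{2n}` with `μ_{2k-1} = μ_{2k} = ν_k`. -/
def doubled {d n : ℕ} (ν : Fin n → Fin d) (i : Fin (2 * n)) : Fin d :=
  ν ⟨(i : ℕ) / 2, by omega⟩

end Sums

end HeatDiag

end

/-! Fix the base point `y = x` and study the numbers `D_{μ_J} a_q(·, x)` at `x`. Moving `P = (z -
y)^ρ D_ρ` through `D_{μ_J}` produces the factor `#J` and, for every non-empty `s ⊆ J`, a vertex with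
indices `s` times `D_{μ_{J∖s}}` (`radialD_covDs`). On the diagonal `P` vanishes, so the defining
equations become, for each `q`, a system triangular in `J` with diagonal entries `q + #J`. Its
source is absent for `q = 0` and is `D_{μ_K} D_c D_c a_{q-1}`, summed over `c`, for `q ≥ 1`.

Back substitution in such a system is a sum over ordered partitions (`orderedSum_rec`,
`orderedSum_solve`), with the diagonal entries as lower elements; this is `Σ̂`. Hence `D_{μ_J} a_q`
is a sum over splittings of `J` into a removed set, carried by `Σ̂`, and a kept set `K`, to which
the pair `c, c` is appended at level `q - 1` (`covDs_coeff_succ`). Giving that pair the two next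
lower labels keeps multi-indices decreasing, so the step iterates down to `a_0`
(`covDs_coeff_eq_sum_chain`). Grouping the removed sets by cardinality gives the sums over `p` and
`σ`. -/

namespace HeatDiag

/-! ### Covariant calculus and the commutation of the radial operator with derivatives -/

section Analysis

variable {R : Type*} [NormedRing R] [NormedAlgebra ℝ R] {d : ℕ}

theorem contDiff_pd {f : E d → R} (hf : ContDiff ℝ ∞ f) (μ : Fin d) : ContDiff ℝ ∞ (pd μ f) :=
  (hf.fderiv_right (m := ∞) (by simp)).clm_apply contDiff_const

theorem contDiff_covD {B : Fin d → E d → R} (hB : ∀ μ, ContDiff ℝ ∞ (B μ)) {f : E d → R}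
    (hf : ContDiff ℝ ∞ f) (μ : Fin d) : ContDiff ℝ ∞ (covD B μ f) :=
  (contDiff_pd hf μ).add ((hB μ).mul hf)

theorem contDiff_nabla {B : Fin d → E d → R} (hB : ∀ μ, ContDiff ℝ ∞ (B μ)) {f : E d → R}
    (hf : ContDiff ℝ ∞ f) (μ : Fin d) : ContDiff ℝ ∞ (nabla B μ f) :=
  (contDiff_pd hf μ).add (((hB μ).mul hf).sub (hf.mul (hB μ)))

theorem contDiff_nablas {B : Fin d → E d → R} (hB : ∀ μ, ContDiff ℝ ∞ (B μ)) {f : E d → R}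
    (hf : ContDiff ℝ ∞ f) (L : List (Fin d)) : ContDiff ℝ ∞ (nablas B L f) := by
  induction L with
  | nil => exact hf
  | cons μ L ih => exact contDiff_nabla hB ih μ

theorem contDiff_fieldStrength {B : Fin d → E d → R} (hB : ∀ μ, ContDiff ℝ ∞ (B μ))
    (ν μ : Fin d) : ContDiff ℝ ∞ (fieldStrength B ν μ) :=
  ((contDiff_pd (hB μ) ν).sub (contDiff_pd (hB ν) μ)).add
    (((hB ν).mul (hB μ)).sub ((hB μ).mul (hB ν)))

theorem contDiff_coord (y : E d) (ρ : Fin d) : ContDiff ℝ ∞ (fun z : E d => z ρ - y ρ) := by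
  fun_prop

theorem contDiff_radial (y : E d) {g : Fin d → E d → R} (hg : ∀ ρ, ContDiff ℝ ∞ (g ρ)) :
    ContDiff ℝ ∞ (fun z : E d => ∑ ρ : Fin d, (z ρ - y ρ) • g ρ z) :=
  ContDiff.sum fun ρ _ => (contDiff_coord y ρ).smul (hg ρ)

theorem contDiff_vertex {B : Fin d → E d → R} (hB : ∀ μ, ContDiff ℝ ∞ (B μ)) (y : E d) :
    ∀ L : List (Fin d), ContDiff ℝ ∞ (vertex B y L)
  | [] => contDiff_const
  | [ν] => contDiff_radial y fun ρ => contDiff_fieldStrength hB ρ ν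
  | μ :: ν :: L => contDiff_nabla hB (contDiff_vertex hB y (ν :: L)) μ

theorem contDiff_radialD {B : Fin d → E d → R} (hB : ∀ μ, ContDiff ℝ ∞ (B μ)) (y : E d)
    {f : E d → R} (hf : ContDiff ℝ ∞ f) : ContDiff ℝ ∞ (radialD B y f) :=
  contDiff_radial y fun ρ => contDiff_covD hB hf ρ

theorem radialD_self (B : Fin d → E d → R) (y : E d) (f : E d → R) : radialD B y f y = 0 := by
  simp [radialD]

theorem smooth_differentiableAt {f : E d → R} (hf : ContDiff ℝ ∞ f) (x : E d) :
    DifferentiableAt ℝ f x :=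
  hf.differentiable (by simp) x

theorem pd_add {f g : E d → R} (hf : ContDiff ℝ ∞ f) (hg : ContDiff ℝ ∞ g) (μ : Fin d) (x : E d) :
    pd μ (fun z => f z + g z) x = pd μ f x + pd μ g x := by
  simp only [pd]
  rw [fderiv_fun_add (smooth_differentiableAt hf x) (smooth_differentiableAt hg x)]
  rfl

theorem pd_const_smul {f : E d → R} (hf : ContDiff ℝ ∞ f) (c : ℝ) (μ : Fin d) (x : E d) :
    pd μ (fun z => c • f z) x = c • pd μ f x := by
  simp only [pd]
  rw [fderiv_fun_const_smul (smooth_differentiableAt hf x)]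
  rfl

theorem pd_sum {ι : Type*} (s : Finset ι) {f : ι → E d → R} (hf : ∀ i, ContDiff ℝ ∞ (f i))
    (μ : Fin d) (x : E d) :
    pd μ (fun z => ∑ i ∈ s, f i z) x = ∑ i ∈ s, pd μ (f i) x := by
  simp only [pd]
  rw [fderiv_fun_sum fun i _ => smooth_differentiableAt (hf i) x]
  simp

theorem pd_mul {f g : E d → R} (hf : ContDiff ℝ ∞ f) (hg : ContDiff ℝ ∞ g) (μ : Fin d) (x : E d) :
    pd μ (fun z => f z * g z) x = pd μ f x * g x + f x * pd μ g x := by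
  simp only [pd]
  rw [fderiv_fun_mul' (smooth_differentiableAt hf x) (smooth_differentiableAt hg x)]
  simp [add_comm]

theorem pd_coord_smul {g : E d → R} (hg : ContDiff ℝ ∞ g) (y : E d) (ρ μ : Fin d) (x : E d) :
    pd μ (fun z => (z ρ - y ρ) • g z) x
      = (if μ = ρ then g x else 0) + (x ρ - y ρ) • pd μ g x := by
  have h : HasFDerivAt (fun z : E d => z ρ - y ρ) (EuclideanSpace.proj ρ : E d →L[ℝ] ℝ) x :=
    (EuclideanSpace.proj ρ : E d →L[ℝ] ℝ).hasFDerivAt.sub_const _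
  have h2 := h.smul (smooth_differentiableAt hg x).hasFDerivAt
  simp only [pd]
  rw [HasFDerivAt.fderiv (f := fun z : E d => (z ρ - y ρ) • g z) h2]
  by_cases hμ : μ = ρ
  · subst hμ; simp [add_comm]
  · simp [hμ, add_comm, Ne.symm hμ]

theorem pd_comm {f : E d → R} (hf : ContDiff ℝ ∞ f) (μ ν : Fin d) (x : E d) :
    pd μ (pd ν f) x = pd ν (pd μ f) x := by
  have hs : IsSymmSndFDerivAt ℝ f x :=
    hf.contDiffAt.isSymmSndFDerivAt (by
      rw [minSmoothness_of_isRCLikeNormedField]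
      exact WithTop.coe_le_coe.2 (le_top : (2 : ℕ∞) ≤ ⊤))
  have hd : DifferentiableAt ℝ (fderiv ℝ f) x :=
    (hf.fderiv_right (m := ∞) (by simp)).differentiable (by simp) x
  have key : ∀ a b : Fin d, pd a (pd b f) x
      = fderiv ℝ (fderiv ℝ f) x (EuclideanSpace.single a 1) (EuclideanSpace.single b 1) := by
    intro a b
    unfold pd
    rw [fderiv_clm_apply hd (differentiableAt_const _)]
    simp
  rw [key, key, hs.eq]

theorem covD_add (B : Fin d → E d → R) {f g : E d → R} (hf : ContDiff ℝ ∞ f)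
    (hg : ContDiff ℝ ∞ g) (μ : Fin d) (x : E d) :
    covD B μ (fun z => f z + g z) x = covD B μ f x + covD B μ g x := by
  simp only [covD]
  rw [pd_add hf hg, mul_add]
  abel

theorem covD_const_smul (B : Fin d → E d → R) {f : E d → R} (hf : ContDiff ℝ ∞ f) (c : ℝ)
    (μ : Fin d) (x : E d) : covD B μ (fun z => c • f z) x = c • covD B μ f x := by
  simp only [covD]
  rw [pd_const_smul hf, smul_add, mul_smul_comm]

theorem covD_sum (B : Fin d → E d → R) {ι : Type*} (s : Finset ι) {f : ι → E d → R}
    (hf : ∀ i, ContDiff ℝ ∞ (f i)) (μ : Fin d) (x : E d) :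
    covD B μ (fun z => ∑ i ∈ s, f i z) x = ∑ i ∈ s, covD B μ (f i) x := by
  simp only [covD]
  rw [pd_sum s hf, Finset.mul_sum, Finset.sum_add_distrib]

/-- The terms `f B_μ g` cancel. This mixed Leibniz rule is why vertices are differentiated by `∇`
while the coefficients keep `D`. -/
theorem covD_mul (B : Fin d → E d → R) {f g : E d → R} (hf : ContDiff ℝ ∞ f)
    (hg : ContDiff ℝ ∞ g) (μ : Fin d) (x : E d) :
    covD B μ (fun z => f z * g z) x = nabla B μ f x * g x + f x * covD B μ g x := by
  simp only [covD, nabla]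
  rw [pd_mul hf hg]
  noncomm_ring

theorem covD_radial (B : Fin d → E d → R) (y : E d) {g : Fin d → E d → R}
    (hg : ∀ ρ, ContDiff ℝ ∞ (g ρ)) (μ : Fin d) (x : E d) :
    covD B μ (fun z => ∑ ρ : Fin d, (z ρ - y ρ) • g ρ z) x
      = g μ x + ∑ ρ : Fin d, (x ρ - y ρ) • covD B μ (g ρ) x := by
  have hs : ∀ ρ, ContDiff ℝ ∞ fun z : E d => (z ρ - y ρ) • g ρ z :=
    fun ρ => (contDiff_coord y ρ).smul (hg ρ)
  rw [covD_sum B _ hs]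
  simp only [covD, pd_coord_smul (hg _), smul_add, mul_smul_comm, add_assoc]
  rw [Finset.sum_add_distrib]
  simp

theorem nabla_radial (B : Fin d → E d → R) (y : E d) {g : Fin d → E d → R}
    (hg : ∀ ρ, ContDiff ℝ ∞ (g ρ)) (μ : Fin d) (x : E d) :
    nabla B μ (fun z => ∑ ρ : Fin d, (z ρ - y ρ) • g ρ z) x
      = g μ x + ∑ ρ : Fin d, (x ρ - y ρ) • nabla B μ (g ρ) x := by
  have hs : ∀ ρ, ContDiff ℝ ∞ fun z : E d => (z ρ - y ρ) • g ρ z :=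
    fun ρ => (contDiff_coord y ρ).smul (hg ρ)
  simp only [nabla]
  rw [pd_sum _ hs]
  simp only [pd_coord_smul (hg _), smul_add, smul_sub, Finset.sum_add_distrib,
    Finset.sum_sub_distrib, Finset.mul_sum, Finset.sum_mul, mul_smul_comm, smul_mul_assoc]
  simp [add_assoc]

theorem nabla_add (B : Fin d → E d → R) {f g : E d → R} (hf : ContDiff ℝ ∞ f)
    (hg : ContDiff ℝ ∞ g) (μ : Fin d) (x : E d) :
    nabla B μ (fun z => f z + g z) x = nabla B μ f x + nabla B μ g x := by
  simp only [nabla]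
  rw [pd_add hf hg]
  noncomm_ring

theorem nabla_sum (B : Fin d → E d → R) {ι : Type*} (s : Finset ι) {f : ι → E d → R}
    (hf : ∀ i, ContDiff ℝ ∞ (f i)) (μ : Fin d) (x : E d) :
    nabla B μ (fun z => ∑ i ∈ s, f i z) x = ∑ i ∈ s, nabla B μ (f i) x := by
  simp only [nabla]
  rw [pd_sum s hf, Finset.mul_sum, Finset.sum_mul, Finset.sum_add_distrib, Finset.sum_sub_distrib]

theorem covD_comm {B : Fin d → E d → R} (hB : ∀ μ, ContDiff ℝ ∞ (B μ)) {f : E d → R}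
    (hf : ContDiff ℝ ∞ f) (μ ν : Fin d) (x : E d) :
    covD B μ (covD B ν f) x = covD B ν (covD B μ f) x + fieldStrength B μ ν x * f x := by
  have key : ∀ a b : Fin d, covD B a (covD B b f) x
      = pd a (pd b f) x + (pd a (B b) x * f x + B b x * pd a f x)
        + B a x * (pd b f x + B b x * f x) := by
    intro a b
    rw [← pd_mul (hB b) hf, ← pd_add (contDiff_pd hf b) ((hB b).mul hf)]
    rfl
  rw [key, key, pd_comm hf μ ν, fieldStrength]
  noncomm_ring

/-- `D_ν` either hits the linear factor of the radial operator, giving `D_ν f`, or passes to `D_ρ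
f`, where exchanging the two derivatives costs `F_{ρν}`; contracted with `(x - y)^ρ` this is the
one-index vertex. -/
theorem radialD_covD {B : Fin d → E d → R} (hB : ∀ μ, ContDiff ℝ ∞ (B μ)) (y : E d)
    {f : E d → R} (hf : ContDiff ℝ ∞ f) (ν : Fin d) (x : E d) :
    radialD B y (covD B ν f) x + covD B ν f x
      = covD B ν (radialD B y f) x + vertex B y [ν] x * f x := by
  have h : covD B ν (radialD B y f) x
      = covD B ν f x + ∑ ρ : Fin d, (x ρ - y ρ) • covD B ν (covD B ρ f) x :=
    covD_radial B y (fun ρ => contDiff_covD hB hf ρ) ν x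
  rw [h]
  simp only [radialD, vertex, covD_comm hB hf _ ν, smul_add, Finset.sum_add_distrib,
    Finset.sum_mul, smul_mul_assoc]
  abel

/-- The factor `(z - y)^ρ` is linear, so at most one derivative can hit it. If `∇_{μ_k}` does,
`F_{μ_k ν}` remains under the others; if none does, the factor survives and vanishes on the
diagonal. -/
theorem vertex_append {B : Fin d → E d → R} (hB : ∀ μ, ContDiff ℝ ∞ (B μ)) (y : E d)
    (ν : Fin d) (L : List (Fin d)) (x : E d) :
    vertex B y (L ++ [ν]) x
      = ∑ k : Fin L.length, nablas B (L.eraseIdx k) (fieldStrength B (L.get k) ν) x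
        + ∑ ρ : Fin d, (x ρ - y ρ) • nablas B L (fieldStrength B ρ ν) x := by
  induction L generalizing x with
  | nil => simp [vertex, nablas]
  | cons μ L ih =>
    have hs : ∀ (M : List (Fin d)) (ρ : Fin d), ContDiff ℝ ∞ (nablas B M (fieldStrength B ρ ν)) :=
      fun M ρ => contDiff_nablas hB (contDiff_fieldStrength hB ρ ν) M
    have hv : vertex B y (μ :: L ++ [ν]) = nabla B μ (vertex B y (L ++ [ν])) := by
      cases L <;> rfl
    rw [hv, funext ih, nabla_add B (ContDiff.sum fun k _ => hs _ _)
      (contDiff_radial y fun ρ => hs L ρ), nabla_sum B _ (fun k => hs _ _),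
      nabla_radial B y (fun ρ => hs L ρ)]
    simp only [List.length_cons]
    rw [Fin.sum_univ_succ]
    simp only [Fin.val_zero, List.eraseIdx_cons_zero, List.get_cons_zero, Fin.val_succ,
      List.eraseIdx_cons_succ, List.get_cons_succ']
    simp only [nablas, List.foldr_cons]
    abel

/-- `D_{μ_1} ⋯ D_{μ_m} f` for the multi-index `[μ_1, …, μ_m]`. -/
noncomputable def covDs (B : Fin d → E d → R) (L : List (Fin d)) (f : E d → R) : E d → R :=
  L.foldr (covD B) f

theorem contDiff_covDs {B : Fin d → E d → R} (hB : ∀ μ, ContDiff ℝ ∞ (B μ)) {f : E d → R}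
    (hf : ContDiff ℝ ∞ f) (L : List (Fin d)) : ContDiff ℝ ∞ (covDs B L f) := by
  induction L with
  | nil => exact hf
  | cons μ L ih => exact contDiff_covD hB ih μ

theorem covDs_add {B : Fin d → E d → R} (hB : ∀ μ, ContDiff ℝ ∞ (B μ)) {f g : E d → R}
    (hf : ContDiff ℝ ∞ f) (hg : ContDiff ℝ ∞ g) (L : List (Fin d)) (x : E d) :
    covDs B L (fun z => f z + g z) x = covDs B L f x + covDs B L g x := by
  induction L generalizing x with
  | nil => rfl
  | cons μ L ih =>
    change covD B μ (covDs B L fun z => f z + g z) x = _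
    rw [funext ih]
    exact covD_add B (contDiff_covDs hB hf L) (contDiff_covDs hB hg L) μ x

theorem covDs_const_smul {B : Fin d → E d → R} (hB : ∀ μ, ContDiff ℝ ∞ (B μ)) {f : E d → R}
    (hf : ContDiff ℝ ∞ f) (c : ℝ) (L : List (Fin d)) (x : E d) :
    covDs B L (fun z => c • f z) x = c • covDs B L f x := by
  induction L generalizing x with
  | nil => rfl
  | cons μ L ih =>
    change covD B μ (covDs B L fun z => c • f z) x = _
    rw [funext ih]
    exact covD_const_smul B (contDiff_covDs hB hf L) c μ x

theorem covDs_sum {B : Fin d → E d → R} (hB : ∀ μ, ContDiff ℝ ∞ (B μ)) {ι : Type*}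
    (s : Finset ι) {f : ι → E d → R} (hf : ∀ i, ContDiff ℝ ∞ (f i)) (L : List (Fin d)) (x : E d) :
    covDs B L (fun z => ∑ i ∈ s, f i z) x = ∑ i ∈ s, covDs B L (f i) x := by
  induction L generalizing x with
  | nil => rfl
  | cons μ L ih =>
    change covD B μ (covDs B L fun z => ∑ i ∈ s, f i z) x = _
    rw [funext ih]
    exact covD_sum B s (fun i => contDiff_covDs hB (hf i) L) μ x

theorem covDs_zero {B : Fin d → E d → R} (L : List (Fin d)) (x : E d) :
    covDs B L (fun _ => 0) x = 0 := by
  induction L generalizing x with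
  | nil => rfl
  | cons μ L ih =>
    change covD B μ (covDs B L fun _ => 0) x = _
    rw [funext ih]
    simp [covD, pd]

/-! ### Decreasing multi-indices and the radial operator -/

section Multi

variable {m : ℕ}

theorem multi_empty (μ : Fin m → Fin d) : multi μ ∅ = [] := by
  simp [multi]

theorem multi_eq_nil {μ : Fin m → Fin d} {J : Finset (Fin m)} : multi μ J = [] ↔ J = ∅ := by
  rw [multi, List.map_eq_nil_iff, List.reverse_eq_nil_iff, ← List.length_eq_zero_iff,
    Finset.length_sort, Finset.card_eq_zero]

theorem multi_union (μ : Fin m → Fin d) {J K : Finset (Fin m)} (h : ∀ i ∈ J, ∀ j ∈ K, i < j) :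
    multi μ (J ∪ K) = multi μ K ++ multi μ J := by
  have hs : (J ∪ K).sort (· ≤ ·) = J.sort (· ≤ ·) ++ K.sort (· ≤ ·) := by
    refine List.Perm.eq_of_pairwise' (r := (· ≤ ·)) (Finset.pairwise_sort _ _) ?_ ?_
    · rw [List.pairwise_append]
      refine ⟨Finset.pairwise_sort _ _, Finset.pairwise_sort _ _, fun a ha b hb => ?_⟩
      exact (h a (by simpa using ha) b (by simpa using hb)).le
    · refine (List.perm_ext_iff_of_nodup (Finset.sort_nodup _ _) ?_).2 fun a => by simp
      rw [List.nodup_append]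
      refine ⟨Finset.sort_nodup _ _, Finset.sort_nodup _ _, fun a ha b hb => ?_⟩
      exact (h a (by simpa using ha) b (by simpa using hb)).ne
  simp [multi, hs]

theorem multi_singleton (μ : Fin m → Fin d) (i : Fin m) : multi μ {i} = [μ i] := by
  simp [multi]

theorem multi_insert (μ : Fin m → Fin d) {J : Finset (Fin m)} {i : Fin m} (h : ∀ j ∈ J, j < i) :
    multi μ (insert i J) = μ i :: multi μ J := by
  rw [Finset.insert_eq, Finset.union_comm, multi_union μ (by simpa using h), multi_singleton]
  rfl

/-- Moving the radial operator through the covariant derivatives `D_{μ_J}`. -/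
theorem radialD_covDs {B : Fin d → E d → R} (hB : ∀ μ, ContDiff ℝ ∞ (B μ)) (y : E d)
    {f : E d → R} (hf : ContDiff ℝ ∞ f) (μ : Fin m → Fin d) (J : Finset (Fin m)) (x : E d) :
    radialD B y (covDs B (multi μ J) f) x + (J.card : ℝ) • covDs B (multi μ J) f x
      = covDs B (multi μ J) (radialD B y f) x
        + ∑ s ∈ J.powerset, if s = ∅ then 0 else
            vertex B y (multi μ s) x * covDs B (multi μ (J \ s)) f x := by
  -- The largest label stands leftmost, so inserting it applies one more `D` to the whole inductive
  -- identity.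
  induction J using Finset.induction_on_max generalizing x with
  | empty => simp [multi_empty, covDs]
  | insert i J hi ih =>
    have hiJ : i ∉ J := fun h => lt_irrefl _ (hi i h)
    set g := covDs B (multi μ J) f with hg
    have hgs : ContDiff ℝ ∞ g := contDiff_covDs hB hf _
    have hD : covDs B (multi μ (insert i J)) f = covD B (μ i) g := by
      rw [multi_insert μ hi]; rfl
    have hD2 : covDs B (multi μ (insert i J)) (radialD B y f)
        = covD B (μ i) (covDs B (multi μ J) (radialD B y f)) := by
      rw [multi_insert μ hi]; rfl
    have hPf := contDiff_covDs hB (contDiff_radialD hB y hf) (multi μ J)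
    let t : Finset (Fin m) → E d → R := fun s z => if s = ∅ then 0 else
            vertex B y (multi μ s) z * covDs B (multi μ (J \ s)) f z
    have hts : ∀ s, ContDiff ℝ ∞ (t s) := by
      intro s
      by_cases hs : s = ∅
      · simp only [t, hs, if_true]; exact contDiff_const
      · simp only [t, hs, if_false]
        exact (contDiff_vertex hB y _).mul (contDiff_covDs hB hf _)
    have hdiff := congrFun (congrArg (covD B (μ i)) (funext ih)) x
    rw [covD_add B (contDiff_radialD hB y hgs) (hgs.const_smul (J.card : ℝ)),
      covD_const_smul B hgs, covD_add B hPf (ContDiff.sum fun s _ => hts s),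
      covD_sum B _ hts] at hdiff
    have hrad := radialD_covD hB y hgs (μ i) x
    -- By Leibniz the new label joins `s` or its complement, which yields all subsets of `insert i
    -- J`. The subset `{i}` does not arise this way, since the term of `∅` is zero; the subtracted
    -- correction accounts for it, and `hrad` supplies that vertex.
    have hterm : ∀ s ∈ J.powerset, covD B (μ i) (t s) x
        = (if s = ∅ then 0 else
            vertex B y (multi μ s) x * covDs B (multi μ (insert i J \ s)) f x)
          + ((if insert i s = ∅ then 0 else
            vertex B y (multi μ (insert i s)) x * covDs B (multi μ (insert i J \ insert i s)) f x)
          - if s = ∅ then vertex B y [μ i] x * g x else 0) := by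
      intro s hs
      rw [Finset.mem_powerset] at hs
      have hsi : ∀ j ∈ s, j < i := fun j hj => hi j (hs hj)
      have his : i ∉ s := fun h => hiJ (hs h)
      have e1 : insert i J \ insert i s = J \ s := by
        ext j; simp only [Finset.mem_sdiff, Finset.mem_insert]; grind
      have e2 : insert i J \ s = insert i (J \ s) := by
        ext j; simp only [Finset.mem_sdiff, Finset.mem_insert]; grind
      rw [e1, e2, multi_insert μ hsi,
        multi_insert μ (J := J \ s) fun j hj => hi j (Finset.sdiff_subset hj)]
      by_cases h0 : s = ∅
      · subst h0
        have : t ∅ = fun _ => (0 : R) := by simp [t]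
        rw [this]
        simp [covD, pd, multi_empty, hg]
      · have : t s = fun z => vertex B y (multi μ s) z * covDs B (multi μ (J \ s)) f z := by
          simp [t, h0]
        rw [this, covD_mul B (contDiff_vertex hB y _) (contDiff_covDs hB hf _)]
        have hv : vertex B y (μ i :: multi μ s) = nabla B (μ i) (vertex B y (multi μ s)) := by
          have hne : multi μ s ≠ [] := by rwa [Ne, multi_eq_nil]
          revert hne
          cases multi μ s with
          | nil => exact fun h => absurd rfl h
          | cons a l => exact fun _ => rfl
        simp only [h0, if_false, hv, Finset.insert_ne_empty, sub_zero]
        rw [add_comm]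
        rfl
    rw [Finset.sum_congr rfl hterm, Finset.sum_add_distrib, Finset.sum_sub_distrib,
      Finset.sum_ite_eq' J.powerset ∅, if_pos (Finset.empty_mem_powerset J)] at hdiff
    rw [Finset.sum_powerset_insert hiJ, hD, hD2, Finset.card_insert_of_notMem hiJ]
    push_cast
    rw [add_smul, one_smul]
    linear_combination (norm := module) hdiff + hrad

end Multi

end Analysis

/-! ### Ordered partitions and the recursion of their sums -/

section OrderedPartitions

variable {m : ℕ}

theorem mem_orderedPartitions {J : Finset (Fin m)} {k : ℕ} {σ : Fin k → Finset (Fin m)} :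
    σ ∈ orderedPartitions J k ↔ (∀ i, (σ i).Nonempty) ∧ (∀ i j, i ≠ j → Disjoint (σ i) (σ j)) ∧
      Finset.univ.biUnion σ = J := by
  simp [orderedPartitions]

theorem orderedPartitions_subset {J : Finset (Fin m)} {k : ℕ} {σ : Fin k → Finset (Fin m)}
    (h : σ ∈ orderedPartitions J k) (i : Fin k) : σ i ⊆ J := by
  rw [← (mem_orderedPartitions.1 h).2.2]
  exact Finset.subset_biUnion_of_mem σ (Finset.mem_univ i)

theorem orderedPartitions_eq_empty {J : Finset (Fin m)} {k : ℕ} (h : J.card < k) :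
    orderedPartitions J k = ∅ := by
  rw [Finset.eq_empty_iff_forall_notMem]
  intro σ hσ
  obtain ⟨h1, h2, h3⟩ := mem_orderedPartitions.1 hσ
  have hc : J.card = ∑ i, (σ i).card := by
    rw [← h3]
    exact Finset.card_biUnion fun i _ j _ hij => h2 i j hij
  have : ∑ _i : Fin k, 1 ≤ ∑ i, (σ i).card :=
    Finset.sum_le_sum fun i _ => Finset.card_pos.2 (h1 i)
  simp at this
  omega

theorem orderedPartitions_zero {J : Finset (Fin m)} (h : J ≠ ∅) : orderedPartitions J 0 = ∅ := by
  rw [Finset.eq_empty_iff_forall_notMem]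
  intro σ hσ
  exact h (by simpa using (mem_orderedPartitions.1 hσ).2.2.symm)

theorem snoc_mem_orderedPartitions {J s : Finset (Fin m)} {k : ℕ} {τ : Fin k → Finset (Fin m)} :
    (Fin.snoc τ s : Fin (k + 1) → Finset (Fin m)) ∈ orderedPartitions J (k + 1)
      ↔ s ∈ J.powerset ∧ s ≠ ∅ ∧ τ ∈ orderedPartitions (J \ s) k := by
  simp only [mem_orderedPartitions, Finset.mem_powerset, ← Finset.nonempty_iff_ne_empty]
  have hU : Finset.univ.biUnion (Fin.snoc τ s : Fin (k + 1) → Finset (Fin m))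
      = Finset.univ.biUnion τ ∪ s := by
    ext i
    simp [Fin.exists_fin_succ']
  have hl : ∀ i : Fin k, (Fin.last k = i.castSucc) = False :=
    fun i => eq_false (Fin.castSucc_ne_last i).symm
  rw [hU]
  simp only [hl, Fin.forall_fin_succ', Fin.snoc_castSucc, Fin.snoc_last, ne_eq, Fin.castSucc_inj,
    Fin.castSucc_ne_last, not_false_eq_true, forall_const, not_true_eq_false,
    false_imp_iff, and_true]
  constructor
  · rintro ⟨⟨h1, h2⟩, ⟨h3, h4⟩, rfl⟩
    refine ⟨Finset.subset_union_right, h2, h1, fun i => (h3 i).1, ?_⟩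
    rw [Finset.union_sdiff_cancel_right]
    exact (Finset.disjoint_biUnion_left _ _ _).2 fun i _ => (h3 i).2
  · rintro ⟨h1, h2, h3, h4, h5⟩
    have hd : ∀ i, Disjoint (τ i) s := by
      have := (Finset.disjoint_biUnion_left Finset.univ τ s).1 (by
        rw [h5]; exact Finset.sdiff_disjoint)
      exact fun i => this i (Finset.mem_univ i)
    exact ⟨⟨h3, h2⟩, ⟨fun i => ⟨h4 i, hd i⟩, fun i => (hd i).symm⟩, by
      rw [h5, Finset.sdiff_union_of_subset h1]⟩

theorem sum_orderedPartitions_succ {M : Type*} [AddCommMonoid M] (J : Finset (Fin m)) (k : ℕ)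
    (f : (Fin (k + 1) → Finset (Fin m)) → M) :
    ∑ σ ∈ orderedPartitions J (k + 1), f σ
      = ∑ s ∈ J.powerset with s ≠ ∅, ∑ τ ∈ orderedPartitions (J \ s) k, f (Fin.snoc τ s) := by
  rw [Finset.sum_sigma']
  refine Finset.sum_bij' (fun σ _ => ⟨σ (Fin.last k), Fin.init σ⟩)
    (fun p _ => Fin.snoc p.2 p.1) ?_ ?_ ?_ ?_ ?_
  · intro σ hσ
    rw [← Fin.snoc_init_self σ, snoc_mem_orderedPartitions] at hσ
    simpa [and_assoc] using hσ
  · rintro ⟨s, τ⟩ hp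
    rw [snoc_mem_orderedPartitions]
    simpa [and_assoc] using hp
  · intro σ _
    exact Fin.snoc_init_self σ
  · rintro ⟨s, τ⟩ _
    simp
  · intro σ _
    simp

theorem cumCard_snoc_castSucc {k : ℕ} (τ : Fin k → Finset (Fin m)) (s : Finset (Fin m))
    (i : Fin k) : cumCard (Fin.snoc τ s : Fin (k + 1) → Finset (Fin m)) i.castSucc
      = cumCard τ i := by
  unfold cumCard
  congr 1
  ext j
  simp [Fin.exists_fin_succ']

theorem cumCard_last {J : Finset (Fin m)} {k : ℕ} {σ : Fin (k + 1) → Finset (Fin m)}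
    (h : σ ∈ orderedPartitions J (k + 1)) : cumCard σ (Fin.last k) = J.card := by
  have : Finset.Iic (Fin.last k) = Finset.univ := by
    ext i; simp [Fin.le_last]
  rw [cumCard, this, (mem_orderedPartitions.1 h).2.2]

/-- The sum over ordered partitions of the ordered products of `s (σ_i) (l + #(σ_1 ∪ ⋯ ∪ σ_i))`. -/
def orderedSum {R : Type*} [Semiring R] (s : Finset (Fin m) → ℕ → R) (l : ℕ)
    (J : Finset (Fin m)) : R :=
  ∑ k ∈ Finset.range (J.card + 1), ∑ σ ∈ orderedPartitions J k,
    ((List.ofFn fun i : Fin k => s (σ i) (l + cumCard σ i)).reverse).prod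

variable {R : Type*} [Semiring R]

/-- More than `#J` non-empty disjoint blocks are impossible, so a common upper limit may be used for
all the remainders `J \ t`. -/
theorem orderedSum_eq_of_le (s : Finset (Fin m) → ℕ → R) (l : ℕ) {J : Finset (Fin m)} {n : ℕ}
    (h : J.card ≤ n) : orderedSum s l J
      = ∑ k ∈ Finset.range (n + 1), ∑ σ ∈ orderedPartitions J k,
        ((List.ofFn fun i : Fin k => s (σ i) (l + cumCard σ i)).reverse).prod := by
  refine Finset.sum_subset (Finset.range_subset_range.2 (by omega)) fun k _ hk => ?_
  rw [orderedPartitions_eq_empty (by simpa using hk), Finset.sum_empty]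

theorem orderedSum_empty (s : Finset (Fin m) → ℕ → R) (l : ℕ) : orderedSum s l ∅ = 1 := by
  have : orderedPartitions (∅ : Finset (Fin m)) 0 = Finset.univ := by
    ext σ
    simpa [mem_orderedPartitions] using Subsingleton.elim _ _
  simp [orderedSum, this]

/-- The last block is the leftmost factor, and its cumulative cardinality is all of `#J`. Removing
it leaves an ordered partition of the rest with unchanged lower elements. -/
theorem orderedSum_rec (s : Finset (Fin m) → ℕ → R) (l : ℕ) {J : Finset (Fin m)} (hJ : J ≠ ∅) :
    orderedSum s l J
      = ∑ t ∈ J.powerset with t ≠ ∅, s t (l + J.card) * orderedSum s l (J \ t) := by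
  have hpos : 0 < J.card := Finset.card_pos.2 (Finset.nonempty_iff_ne_empty.2 hJ)
  obtain ⟨c, hc⟩ : ∃ c, J.card = c + 1 := ⟨J.card - 1, by omega⟩
  rw [orderedSum, Finset.sum_range_succ', orderedPartitions_zero hJ, Finset.sum_empty, add_zero]
  simp_rw [sum_orderedPartitions_succ]
  rw [Finset.sum_comm]
  refine Finset.sum_congr rfl fun t ht => ?_
  rw [Finset.mem_filter, Finset.mem_powerset] at ht
  have hle : (J \ t).card ≤ c := by
    rw [Finset.card_sdiff_of_subset ht.1]
    have := Finset.card_pos.2 (Finset.nonempty_iff_ne_empty.2 ht.2)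
    omega
  rw [orderedSum_eq_of_le s l hle, hc, Finset.mul_sum]
  refine Finset.sum_congr rfl fun k _ => ?_
  rw [Finset.mul_sum]
  refine Finset.sum_congr rfl fun τ hτ => ?_
  have hmem := snoc_mem_orderedPartitions.2 ⟨Finset.mem_powerset.2 ht.1, ht.2, hτ⟩
  rw [List.ofFn_succ', List.concat_eq_append, List.reverse_append, List.prod_append]
  simp [cumCard_snoc_castSucc, cumCard_last hmem, hc]

theorem orderedSum_congr {s t : Finset (Fin m) → ℕ → R} (l : ℕ) {J : Finset (Fin m)}
    (h : ∀ K ⊆ J, s K = t K) : orderedSum s l J = orderedSum t l J := by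
  refine Finset.sum_congr rfl fun k _ => Finset.sum_congr rfl fun σ hσ => ?_
  simp only [h _ (orderedPartitions_subset hσ _)]

theorem sum_powerset_sdiff_comm {M : Type*} [AddCommMonoid M] (J : Finset (Fin m))
    (f : Finset (Fin m) → Finset (Fin m) → M) :
    ∑ s ∈ J.powerset with s ≠ ∅, ∑ K ∈ (J \ s).powerset, f s K
      = ∑ K ∈ J.powerset, ∑ s ∈ (J \ K).powerset with s ≠ ∅, f s K := by
  refine Finset.sum_comm' fun s K => ?_
  simp only [Finset.mem_filter, Finset.mem_powerset, Finset.subset_sdiff]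
  constructor
  · rintro ⟨⟨h1, h2⟩, h3, h4⟩
    exact ⟨⟨⟨h1, h4.symm⟩, h2⟩, h3⟩
  · rintro ⟨⟨⟨h1, h4⟩, h2⟩, h3⟩
    exact ⟨⟨h1, h2⟩, h3, h4.symm⟩

end OrderedPartitions

/-! ### Triangular systems indexed by subsets -/

section Recursion

variable {R : Type*} [NormedRing R] [NormedAlgebra ℝ R] {m : ℕ}

/-- Solution of the triangular system with a source `h`. -/
theorem orderedSum_solve {W g h : Finset (Fin m) → R} {l : ℕ} (hl : 1 ≤ l)
    (hg : ∀ J, ((l + J.card : ℕ) : ℝ) • g J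
      = h J + ∑ s ∈ J.powerset with s ≠ ∅, W s * g (J \ s)) (J : Finset (Fin m)) :
    g J = ∑ K ∈ J.powerset, ((l + K.card : ℕ) : ℝ)⁻¹ •
      (orderedSum (fun s n => (n : ℝ)⁻¹ • W s) (l + K.card) (J \ K) * h K) := by
  induction J using Finset.strongInduction with
  | H J ih =>
    have hne : ((l + J.card : ℕ) : ℝ) ≠ 0 := by
      rw [Nat.cast_ne_zero]; omega
    have h1 : g J = ((l + J.card : ℕ) : ℝ)⁻¹ • (((l + J.card : ℕ) : ℝ) • g J) :=
      (inv_smul_smul₀ hne _).symm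
    have h2 : ∀ s ∈ J.powerset.filter (· ≠ ∅), W s * g (J \ s)
        = ∑ K ∈ (J \ s).powerset, W s * ((l + K.card : ℕ) : ℝ)⁻¹ •
          (orderedSum (fun s n => (n : ℝ)⁻¹ • W s) (l + K.card) ((J \ s) \ K) * h K) := by
      intro s hs
      rw [Finset.mem_filter, Finset.mem_powerset] at hs
      rw [ih (J \ s) (Finset.sdiff_ssubset hs.1 (Finset.nonempty_iff_ne_empty.2 hs.2)),
        Finset.mul_sum]
    have h3 : h J = ∑ K ∈ J.powerset, if K = J then h K else 0 := by
      rw [Finset.sum_ite_eq' J.powerset J, if_pos (Finset.mem_powerset_self J)]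
    rw [h1, hg, Finset.sum_congr rfl h2, sum_powerset_sdiff_comm, h3, ← Finset.sum_add_distrib,
      Finset.smul_sum]
    refine Finset.sum_congr rfl fun K hK => ?_
    rw [Finset.mem_powerset] at hK
    -- The source at `J` itself enters with the empty product; the sources at smaller sets arrive
    -- through one further block.
    by_cases hKJ : K = J
    · subst hKJ
      simp [orderedSum_empty, Finset.filter_singleton]
    · have hJK : J \ K ≠ ∅ := fun h0 =>
        hKJ (Finset.Subset.antisymm hK (Finset.sdiff_eq_empty_iff_subset.1 h0))
      -- The lower element of the leftmost block equals the diagonal entry being divided out.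
      have hc : l + K.card + (J \ K).card = l + J.card := by
        rw [Finset.card_sdiff_of_subset hK]
        have := Finset.card_le_card hK
        omega
      rw [if_neg hKJ, zero_add, orderedSum_rec _ _ hJK, hc, Finset.sum_mul, Finset.smul_sum,
        Finset.smul_sum]
      refine Finset.sum_congr rfl fun s _ => ?_
      rw [sdiff_right_comm, mul_smul_comm, smul_comm, smul_mul_assoc, smul_mul_assoc, mul_assoc]

/-- Solution of the triangular system without a source. -/
theorem orderedSum_solve_zero {W g : Finset (Fin m) → R} (h0 : g ∅ = 1)
    (hg : ∀ J, (J.card : ℝ) • g J = ∑ s ∈ J.powerset with s ≠ ∅, W s * g (J \ s))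
    (J : Finset (Fin m)) :
    g J = orderedSum (fun s n => (n : ℝ)⁻¹ • W s) 0 J := by
  induction J using Finset.strongInduction with
  | H J ih =>
    by_cases hJ : J = ∅
    · rw [hJ, h0, orderedSum_empty]
    · have hne : (J.card : ℝ) ≠ 0 := by
        rw [Nat.cast_ne_zero]; exact fun h => hJ (Finset.card_eq_zero.1 h)
      rw [← inv_smul_smul₀ hne (g J), hg, orderedSum_rec _ _ hJ, Finset.smul_sum]
      refine Finset.sum_congr rfl fun s hs => ?_
      rw [Finset.mem_filter, Finset.mem_powerset] at hs
      rw [ih (J \ s) (Finset.sdiff_ssubset hs.1 (Finset.nonempty_iff_ne_empty.2 hs.2)),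
        smul_mul_assoc, zero_add]

end Recursion

/-! ### Evaluation of `Υ` and the equations for the coefficients on the diagonal -/

section Evaluation

variable {R : Type*} [NormedRing R] [NormedAlgebra ℝ R] {d : ℕ}

theorem Shat_eq (B : Fin d → E d → R) (x : E d) (L : List (Fin d)) (l : ℕ) :
    Shat B x L l = (l : ℝ)⁻¹ • vertex B x L x := by
  simp [Shat, Upsilon, S, emptyMat, Finsupp.lmapDomain_apply, Finsupp.mapDomain_single]

theorem Upsilon_emptyMat (B : Fin d → E d → R) (x : E d) : Upsilon B x (emptyMat d) = 1 := by
  simp [Upsilon, emptyMat]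

/-- Columns are added on the left and multiplied from left to right, so `Υ` turns `S` into left
multiplication. Products of operators thereby become products of the `Ŝ`. -/
theorem Upsilon_S (B : Fin d → E d → R) (x : E d) (L : List (Fin d)) (l : ℕ) (v : DSpace d) :
    Upsilon B x (S L l v) = Shat B x L l * Upsilon B x v := by
  induction v using Finsupp.induction_linear with
  | zero => simp
  | add v w hv hw => rw [map_add, map_add, map_add, hv, hw, mul_add]
  | single M c =>
    rw [Shat_eq]
    simp only [Upsilon, S, Finsupp.lmapDomain_apply, Finsupp.mapDomain_single,
      Finsupp.linearCombination_single, List.map_cons, List.prod_cons, mul_inv, smul_mul_assoc,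
      mul_smul_comm, mul_smul]
    module

theorem Upsilon_prod (B : Fin d → E d → R) (x : E d) (T : List (List (Fin d) × ℕ)) :
    Upsilon B x ((T.map fun c => S c.1 c.2).prod (emptyMat d))
      = (T.map fun c => Shat B x c.1 c.2).prod := by
  induction T with
  | nil => simp [Upsilon_emptyMat]
  | cons c T ih => simp [Module.End.mul_apply, Upsilon_S, ih]

theorem SigmaHat_eq (B : Fin d → E d → R) (x : E d) {m : ℕ} (l : ℕ) (μ : Fin m → Fin d)
    (J : Finset (Fin m)) :
    SigmaHat B x l μ J = orderedSum (fun s n => Shat B x (multi μ s) n) l J := by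
  simp only [SigmaHat, SigmaOp, orderedSum, LinearMap.sum_apply, map_sum]
  refine Finset.sum_congr rfl fun k _ => Finset.sum_congr rfl fun σ _ => ?_
  have := Upsilon_prod B x
    (List.ofFn fun i : Fin k => (multi μ (σ i), l + cumCard σ i)).reverse
  simpa only [List.map_reverse, List.map_ofFn, Function.comp_def] using this

theorem multi_congr {m : ℕ} {μ μ' : Fin m → Fin d} {J : Finset (Fin m)}
    (h : ∀ j ∈ J, μ j = μ' j) : multi μ J = multi μ' J :=
  List.map_congr_left fun j hj => h j (by simpa using hj)

theorem SigmaHat_congr (B : Fin d → E d → R) (x : E d) {m : ℕ} (l : ℕ) {μ μ' : Fin m → Fin d}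
    {J : Finset (Fin m)} (h : ∀ j ∈ J, μ j = μ' j) :
    SigmaHat B x l μ J = SigmaHat B x l μ' J := by
  rw [SigmaHat_eq, SigmaHat_eq]
  refine orderedSum_congr l fun K hK => ?_
  rw [multi_congr fun j hj => h j (hK hj)]

theorem covDs_coeff_zero {B : Fin d → E d → R} (hB : ∀ μ, ContDiff ℝ ∞ (B μ))
    {a : ℕ → E d → E d → R} (ha : IsSeeleyDeWitt B a) (x : E d) {m : ℕ} (μ : Fin m → Fin d)
    (J : Finset (Fin m)) :
    covDs B (multi μ J) (fun z => a 0 z x) x = SigmaHat B x 0 μ J := by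
  rw [SigmaHat_eq]
  simp only [Shat_eq]
  refine orderedSum_solve_zero (W := fun s => vertex B x (multi μ s) x)
    (g := fun J => covDs B (multi μ J) (fun z => a 0 z x) x) ?_ (fun J => ?_) J
  · simp [multi_empty, covDs, ha.diag]
  · have h := radialD_covDs hB x (ha.smooth 0 x) μ J x
    rw [radialD_self, zero_add, funext fun z => ha.zero z x, covDs_zero, zero_add] at h
    rw [h, Finset.sum_filter]
    exact Finset.sum_congr rfl fun s _ => by by_cases hs : s = ∅ <;> simp [hs]

theorem covDs_coeff_succ {B : Fin d → E d → R} (hB : ∀ μ, ContDiff ℝ ∞ (B μ))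
    {a : ℕ → E d → E d → R} (ha : IsSeeleyDeWitt B a) (x : E d) {m : ℕ} (μ : Fin m → Fin d)
    (q : ℕ) (J : Finset (Fin m)) :
    covDs B (multi μ J) (fun z => a (q + 1) z x) x
      = ∑ K ∈ J.powerset, ((q + 1 + K.card : ℕ) : ℝ)⁻¹ •
        (SigmaHat B x (q + 1 + K.card) μ (J \ K) *
          ∑ c : Fin d, covDs B (multi μ K ++ [c, c]) (fun z => a q z x) x) := by
  simp only [SigmaHat_eq, Shat_eq]
  refine orderedSum_solve (W := fun s => vertex B x (multi μ s) x)
    (g := fun J => covDs B (multi μ J) (fun z => a (q + 1) z x) x)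
    (h := fun K => ∑ c : Fin d, covDs B (multi μ K ++ [c, c]) (fun z => a q z x) x)
    (by omega) (fun J => ?_) J
  have h := radialD_covDs hB x (ha.smooth (q + 1) x) μ J x
  -- The transport equation solved for the radial term; its part `-(q + 1) a_{q+1}` raises the
  -- diagonal entry from `#J` to `q + 1 + #J`.
  have hP : radialD B x (fun z => a (q + 1) z x)
      = fun z => (∑ c : Fin d, covD B c (covD B c fun w => a q w x) z)
        + (-((q : ℝ) + 1)) • a (q + 1) z x := by
    funext z
    have := ha.succ q z x
    rw [A₁, neg_neg] at this
    rw [← this, neg_smul]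
    abel
  have hs : ∀ c : Fin d, ContDiff ℝ ∞ (covD B c (covD B c fun w => a q w x)) :=
    fun c => contDiff_covD hB (contDiff_covD hB (ha.smooth q x) c) c
  rw [radialD_self, zero_add, hP,
    covDs_add hB (ContDiff.sum fun c _ => hs c) ((ha.smooth (q + 1) x).const_smul _),
    covDs_const_smul hB (ha.smooth (q + 1) x), covDs_sum hB _ hs] at h
  have hsum : (∑ s ∈ J.powerset with s ≠ ∅, vertex B x (multi μ s) x *
        covDs B (multi μ (J \ s)) (fun z => a (q + 1) z x) x)
      = ∑ s ∈ J.powerset, if s = ∅ then 0 else vertex B x (multi μ s) x *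
        covDs B (multi μ (J \ s)) (fun z => a (q + 1) z x) x := by
    rw [Finset.sum_filter]
    exact Finset.sum_congr rfl fun s _ => by by_cases hs : s = ∅ <;> simp [hs]
  have happ : ∀ c : Fin d, covDs B (multi μ J ++ [c, c]) (fun z => a q z x)
      = covDs B (multi μ J) (covD B c (covD B c fun w => a q w x)) := by
    intro c
    simp [covDs]
  simp only [hsum, happ]
  push_cast
  rw [add_smul, h]
  module

end Evaluation

/-! ### Iteration down to the zeroth coefficient -/

section Main

variable {n q : ℕ}

/-- The indices of derivatives that may have been produced after `k` further steps, if `J` is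
the set of those present at the coefficient with number `q`. -/
def available (J : Finset (Fin (2 * n))) (q k : ℕ) : Finset (Fin (2 * n)) :=
  J ∪ Finset.univ.filter fun i : Fin (2 * n) => 2 * (q - k) ≤ (i : ℕ) ∧ (i : ℕ) < 2 * q

/-- The admissible choices of the sets of derivatives that are removed at each of `q` steps. -/
def admissible (J : Finset (Fin (2 * n))) (q : ℕ) : Finset (Fin q → Finset (Fin (2 * n))) :=
  Finset.univ.filter fun τ => ∀ k, τ k ⊆ available J q k \ (Finset.Iio k).biUnion τ

/-- The indices `2q` and `2q + 1`. -/
def indexPair (n q : ℕ) : Finset (Fin (2 * n)) :=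
  Finset.univ.filter fun i : Fin (2 * n) => 2 * q ≤ (i : ℕ) ∧ (i : ℕ) < 2 * (q + 1)

theorem mem_admissible {J : Finset (Fin (2 * n))} {τ : Fin q → Finset (Fin (2 * n))} :
    τ ∈ admissible J q ↔ ∀ k, τ k ⊆ available J q k \ (Finset.Iio k).biUnion τ := by
  simp [admissible]

/-- After `s` is removed, the process restarts one level lower from `J \ s` and the new pair. The
bound on `J` keeps `s` away from labels not yet issued. -/
theorem available_succ_sdiff {J s : Finset (Fin (2 * n))} (hJ : ∀ i ∈ J, 2 * (q + 1) ≤ (i : ℕ))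
    (hs : s ⊆ J) (k : ℕ) (U : Finset (Fin (2 * n))) :
    available J (q + 1) (k + 1) \ (s ∪ U) = available ((J \ s) ∪ indexPair n q) q k \ U := by
  ext i
  have h1 : i ∈ s → i ∈ J := fun h => hs h
  have h2 := hJ i
  simp only [available, indexPair, Finset.mem_sdiff, Finset.mem_union, Finset.mem_filter,
    Finset.mem_univ, true_and]
  by_cases hU : i ∈ U
  · simp [hU]
  by_cases hi : i ∈ J
  · have := h2 hi
    by_cases his : i ∈ s
    · simp [hU, his]; omega
    · simp [hU, hi, his]
  · have his : i ∉ s := fun h => hi (h1 h)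
    simp only [hU, hi, his, not_false_eq_true, and_true, false_or, or_self]
    omega

theorem cons_mem_admissible {J s : Finset (Fin (2 * n))} {τ : Fin q → Finset (Fin (2 * n))}
    (hJ : ∀ i ∈ J, 2 * (q + 1) ≤ (i : ℕ)) :
    (Fin.cons s τ : Fin (q + 1) → Finset (Fin (2 * n))) ∈ admissible J (q + 1)
      ↔ s ∈ J.powerset ∧ τ ∈ admissible ((J \ s) ∪ indexPair n q) q := by
  have h0 : available J (q + 1) 0 = J := by
    ext i
    simp only [available, Finset.mem_union, Finset.mem_filter, Finset.mem_univ, true_and]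
    exact or_iff_left fun h => by omega
  have hU : ∀ k : Fin q, (Finset.Iio k.succ).biUnion (Fin.cons s τ : Fin (q + 1) → _)
      = s ∪ (Finset.Iio k).biUnion τ := by
    intro k
    ext i
    simp [Fin.exists_fin_succ]
  have h00 : Finset.Iio (0 : Fin (q + 1)) = ∅ := by
    ext i; simp
  rw [mem_admissible, mem_admissible, Fin.forall_fin_succ]
  simp only [Fin.cons_zero, Fin.cons_succ, Fin.val_zero, Fin.val_succ, h0, hU, h00,
    Finset.biUnion_empty, Finset.sdiff_empty, Finset.mem_powerset]
  refine and_congr_right fun hs => forall_congr' fun k => ?_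
  rw [available_succ_sdiff hJ hs]

theorem sum_admissible_succ {M : Type*} [AddCommMonoid M] {J : Finset (Fin (2 * n))}
    (hJ : ∀ i ∈ J, 2 * (q + 1) ≤ (i : ℕ)) (f : (Fin (q + 1) → Finset (Fin (2 * n))) → M) :
    ∑ τ ∈ admissible J (q + 1), f τ
      = ∑ s ∈ J.powerset, ∑ τ ∈ admissible ((J \ s) ∪ indexPair n q) q, f (Fin.cons s τ) := by
  rw [Finset.sum_sigma']
  refine Finset.sum_bij' (fun τ _ => ⟨τ 0, Fin.tail τ⟩) (fun p _ => Fin.cons p.1 p.2)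
    ?_ ?_ ?_ ?_ ?_
  · intro τ hτ
    rw [← Fin.cons_self_tail τ, cons_mem_admissible hJ] at hτ
    simpa using hτ
  · rintro ⟨s, τ⟩ hp
    rw [cons_mem_admissible hJ]
    simpa using hp
  · intro τ _
    exact Fin.cons_self_tail τ
  · rintro ⟨s, τ⟩ _
    simp
  · intro τ _
    simp

/-- The functions `Fin n → Fin d` that agree with `ν` from the place `q` on. -/
def agreeing {d : ℕ} (ν : Fin n → Fin d) (q : ℕ) : Finset (Fin n → Fin d) :=
  Finset.univ.filter fun ν' => ∀ i : Fin n, q ≤ (i : ℕ) → ν' i = ν i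

theorem sum_agreeing_succ {M : Type*} [AddCommMonoid M] {d : ℕ} (ν : Fin n → Fin d)
    (hq : q < n) (f : (Fin n → Fin d) → M) :
    ∑ ν' ∈ agreeing ν (q + 1), f ν'
      = ∑ c : Fin d, ∑ ν' ∈ agreeing (Function.update ν ⟨q, hq⟩ c) q, f ν' := by
  rw [← Finset.sum_fiberwise (agreeing ν (q + 1)) (fun ν' => ν' ⟨q, hq⟩)]
  refine Finset.sum_congr rfl fun c _ => Finset.sum_congr ?_ fun _ _ => rfl
  ext ν'
  simp only [agreeing, Finset.mem_filter, Finset.mem_univ, true_and]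
  constructor
  · rintro ⟨h1, h2⟩ i hi
    by_cases h : i = ⟨q, hq⟩
    · subst h; simpa using h2
    · rw [Function.update_of_ne h]
      exact h1 i (by have : (i : ℕ) ≠ q := fun e => h (Fin.ext e)
                     omega)
  · intro h
    refine ⟨fun i hi => ?_, by simpa using h ⟨q, hq⟩ le_rfl⟩
    have : i ≠ ⟨q, hq⟩ := fun e => by subst e; simp at hi
    simpa [Function.update_of_ne this] using h i (by omega)

theorem indexPair_eq (hq : q < n) :
    indexPair n q = insert ⟨2 * q + 1, by omega⟩ {⟨2 * q, by omega⟩} := by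
  ext i
  simp only [indexPair, Finset.mem_filter, Finset.mem_univ, true_and, Finset.mem_insert,
    Finset.mem_singleton, Fin.ext_iff]
  omega

theorem card_indexPair (hq : q < n) : (indexPair n q).card = 2 := by
  rw [indexPair_eq hq, Finset.card_pair (by simp [Fin.ext_iff])]

theorem multi_indexPair {d : ℕ} (ν : Fin n → Fin d) (hq : q < n) :
    multi (doubled ν) (indexPair n q) = [ν ⟨q, hq⟩, ν ⟨q, hq⟩] := by
  rw [indexPair_eq hq, multi_insert _ (by simp [Fin.lt_def]), multi_singleton]
  simp only [doubled]
  congr <;> omega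

theorem doubled_agree {d : ℕ} {ν ν' : Fin n → Fin d} (h : ν' ∈ agreeing ν q) {i : Fin (2 * n)}
    (hi : 2 * q ≤ (i : ℕ)) : doubled ν' i = doubled ν i := by
  simp only [agreeing, Finset.mem_filter, Finset.mem_univ, true_and] at h
  exact h _ (by simp only; omega)

theorem update_mem_agreeing {d : ℕ} (ν : Fin n → Fin d) (hq : q < n) (c : Fin d) :
    Function.update ν ⟨q, hq⟩ c ∈ agreeing ν (q + 1) := by
  simp only [agreeing, Finset.mem_filter, Finset.mem_univ, true_and]
  intro i hi
  rw [Function.update_of_ne]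
  exact fun e => by subst e; simp at hi

/-- The new labels lie below all those of `K`, so they land on the right, exactly where `D_c D_c`
acts. -/
theorem multi_update {d : ℕ} (ν : Fin n → Fin d) (hq : q < n) (c : Fin d)
    {K : Finset (Fin (2 * n))} (hK : ∀ i ∈ K, 2 * (q + 1) ≤ (i : ℕ)) :
    multi (doubled (Function.update ν ⟨q, hq⟩ c)) (K ∪ indexPair n q)
      = multi (doubled ν) K ++ [c, c] := by
  rw [Finset.union_comm, multi_union, multi_indexPair _ hq, Function.update_self,
    multi_congr fun i hi => doubled_agree (update_mem_agreeing ν hq c) (hK i hi)]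
  intro i hi j hj
  have := hK j hj
  simp only [indexPair, Finset.mem_filter] at hi
  exact Fin.lt_def.2 (by omega)

theorem sum_Iic_cons (s : ℕ) (f : Fin q → ℕ) (k : Fin q) :
    ∑ j ∈ Finset.Iic k.succ, (Fin.cons s f : Fin (q + 1) → ℕ) j
      = s + ∑ j ∈ Finset.Iic k, f j := by
  have h : ∀ (r : ℕ) (i : Fin r), Finset.Iic i = Finset.univ.filter (· ≤ i) := by
    intro r i; ext j; simp
  rw [h, h, Finset.sum_filter, Finset.sum_filter, Fin.sum_univ_succ]
  simp

variable {R : Type*} [NormedRing R] [NormedAlgebra ℝ R] {d : ℕ}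

/-- The weight of the step `k`, if the steps start from the coefficient with number `q` and from
the derivatives with the indices in `J`. -/
def stepWeight (J : Finset (Fin (2 * n))) (q : ℕ) (τ : Fin q → Finset (Fin (2 * n)))
    (k : Fin q) : ℕ :=
  q + J.card + k - ∑ j ∈ Finset.Iic k, (τ j).card

/-- The contribution of one sequence of `q` steps. -/
noncomputable def chain (B : Fin d → E d → R) (x : E d) (J : Finset (Fin (2 * n))) (q : ℕ)
    (ν : Fin n → Fin d) (τ : Fin q → Finset (Fin (2 * n))) : R :=
  (List.ofFn fun k : Fin q =>
    (stepWeight J q τ k : ℝ)⁻¹ • SigmaHat B x (stepWeight J q τ k) (doubled ν) (τ k)).prod *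
  SigmaHat B x 0 (doubled ν) (available J q q \ Finset.univ.biUnion τ)

theorem chain_cons (B : Fin d → E d → R) (x : E d) {J s : Finset (Fin (2 * n))} (hs : s ⊆ J)
    (hJ : ∀ i ∈ J, 2 * (q + 1) ≤ (i : ℕ)) (hq : q < n)
    (ν : Fin n → Fin d) (τ : Fin q → Finset (Fin (2 * n))) :
    chain B x J (q + 1) ν (Fin.cons s τ)
      = ((q + 1 + (J \ s).card : ℕ) : ℝ)⁻¹ •
        (SigmaHat B x (q + 1 + (J \ s).card) (doubled ν) s *
          chain B x ((J \ s) ∪ indexPair n q) q ν τ) := by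
  have hcard : ((J \ s) ∪ indexPair n q).card = (J \ s).card + 2 := by
    rw [Finset.card_union_of_disjoint, card_indexPair hq]
    rw [Finset.disjoint_left]
    intro i hi hi'
    have := hJ i (Finset.sdiff_subset hi)
    simp only [indexPair, Finset.mem_filter] at hi'
    omega
  have hle := Finset.card_le_card hs
  have hsd := Finset.card_sdiff_of_subset hs
  have h00 : Finset.Iic (0 : Fin (q + 1)) = {0} := by
    ext i; simp
  have hw0 : stepWeight J (q + 1) (Fin.cons s τ) 0 = q + 1 + (J \ s).card := by
    simp only [stepWeight, h00, Finset.sum_singleton, Fin.cons_zero, Fin.val_zero]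
    omega
  -- The level drops by one and a pair adds two derivatives; the net gain of one is the shift from
  -- `k` to `k + 1`.
  have hws : ∀ k : Fin q, stepWeight J (q + 1) (Fin.cons s τ) k.succ
      = stepWeight ((J \ s) ∪ indexPair n q) q τ k := by
    intro k
    have : (fun j => ((Fin.cons s τ : Fin (q + 1) → Finset (Fin (2 * n))) j).card)
        = (Fin.cons s.card fun j => (τ j).card : Fin (q + 1) → ℕ) := by
      funext j
      refine Fin.cases ?_ (fun j => ?_) j <;> simp
    simp only [stepWeight, this, sum_Iic_cons, hcard, Fin.val_succ]
    omega
  have hU : Finset.univ.biUnion (Fin.cons s τ : Fin (q + 1) → Finset (Fin (2 * n)))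
      = s ∪ Finset.univ.biUnion τ := by
    ext i
    simp [Fin.exists_fin_succ]
  rw [chain, List.ofFn_succ, List.prod_cons, hU, available_succ_sdiff hJ hs]
  simp only [hw0, hws, Fin.cons_zero, Fin.cons_succ]
  rw [smul_mul_assoc, smul_mul_assoc, mul_assoc]
  rfl

theorem covDs_coeff_eq_sum_chain {B : Fin d → E d → R} (hB : ∀ μ, ContDiff ℝ ∞ (B μ))
    {a : ℕ → E d → E d → R} (ha : IsSeeleyDeWitt B a) (x : E d) (q : ℕ) (hq : q ≤ n)
    (ν : Fin n → Fin d) (J : Finset (Fin (2 * n))) (hJ : ∀ i ∈ J, 2 * q ≤ (i : ℕ)) :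
    covDs B (multi (doubled ν) J) (fun z => a q z x) x
      = ∑ ν' ∈ agreeing ν q, ∑ τ ∈ admissible J q, chain B x J q ν' τ := by
  induction q generalizing ν J with
  | zero =>
    have h1 : agreeing ν 0 = {ν} := by
      ext ν'
      simp [agreeing, funext_iff]
    have h2 : admissible J 0 = {fun i => i.elim0} := by
      ext τ
      simp [admissible, eq_iff_true_of_subsingleton]
    rw [covDs_coeff_zero hB ha, h1, h2]
    simp [chain, available]
  | succ q ih =>
    rw [covDs_coeff_succ hB ha]
    simp only [sum_admissible_succ hJ]
    rw [Finset.sum_comm]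
    -- The solved system is summed over kept sets, chains over removed sets; complementation in `J`
    -- matches them.
    refine Finset.sum_bij' (fun K _ => J \ K) (fun s _ => J \ s) ?_ ?_ ?_ ?_ ?_
    · intro K _; exact Finset.mem_powerset.2 Finset.sdiff_subset
    · intro K _; exact Finset.mem_powerset.2 Finset.sdiff_subset
    · intro K hK; exact Finset.sdiff_sdiff_eq_self (Finset.mem_powerset.1 hK)
    · intro K hK; exact Finset.sdiff_sdiff_eq_self (Finset.mem_powerset.1 hK)
    intro K hK
    rw [Finset.mem_powerset] at hK
    have hKJ : J \ (J \ K) = K := Finset.sdiff_sdiff_eq_self hK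
    have hlow : ∀ i ∈ K ∪ indexPair n q, 2 * q ≤ (i : ℕ) := by
      intro i hi
      rcases Finset.mem_union.1 hi with h | h
      · have := hJ i (hK h); omega
      · simp only [indexPair, Finset.mem_filter] at h; exact h.2.1
    have hterm : ∀ ν' ∈ agreeing ν (q + 1),
        ∑ τ ∈ admissible (J \ (J \ K) ∪ indexPair n q) q,
          chain B x J (q + 1) ν' (Fin.cons (J \ K) τ)
        = ((q + 1 + K.card : ℕ) : ℝ)⁻¹ • (SigmaHat B x (q + 1 + K.card) (doubled ν) (J \ K) *
          ∑ τ ∈ admissible (K ∪ indexPair n q) q, chain B x (K ∪ indexPair n q) q ν' τ) := by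
      intro ν' hν'
      rw [hKJ, Finset.mul_sum, Finset.smul_sum]
      refine Finset.sum_congr rfl fun τ _ => ?_
      rw [chain_cons B x Finset.sdiff_subset hJ (by omega), hKJ,
        SigmaHat_congr B x _ fun i hi => doubled_agree hν' (hJ i (Finset.sdiff_subset hi))]
    rw [Finset.sum_congr rfl hterm, ← Finset.smul_sum, ← Finset.mul_sum,
      sum_agreeing_succ ν (by omega : q < n)]
    congr 2
    refine Finset.sum_congr rfl fun c _ => ?_
    rw [← ih (by omega) _ _ hlow, multi_update _ _ _ fun i hi => hJ i (hK hi)]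

/-- The first step starts with no derivatives, so nothing can be removed and only the factor `1 / (q
+ 1)` results. This leaves `n - 1` genuine steps and a separate `1 / n`. -/
theorem coeff_diagonal_eq_sum_chain {B : Fin d → E d → R} (hB : ∀ μ, ContDiff ℝ ∞ (B μ))
    {a : ℕ → E d → E d → R} (ha : IsSeeleyDeWitt B a) (x : E d) (q : ℕ) :
    a (q + 1) x x = ((q + 1 : ℕ) : ℝ)⁻¹ • ∑ ν : Fin (q + 1) → Fin d,
      ∑ τ ∈ admissible (indexPair (q + 1) q) q, chain B x (indexPair (q + 1) q) q ν τ := by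
  have h := covDs_coeff_succ hB ha x (Fin.elim0 : Fin 0 → Fin d) q ∅
  simp only [multi_empty, Finset.powerset_empty, Finset.sum_singleton, Finset.card_empty, add_zero,
    Finset.sdiff_self, SigmaHat_eq, orderedSum_empty, one_mul, List.nil_append] at h
  rw [show a (q + 1) x x = covDs B [] (fun z => a (q + 1) z x) x from rfl, h,
    ← Finset.sum_fiberwise Finset.univ (fun ν : Fin (q + 1) → Fin d => ν (Fin.last q))]
  congr 1
  refine Finset.sum_congr rfl fun c _ => ?_
  have h1 : agreeing (n := q + 1) (fun _ => c) q
      = Finset.univ.filter fun ν => ν (Fin.last q) = c := by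
    ext ν
    simp only [agreeing, Finset.mem_filter, Finset.mem_univ, true_and]
    constructor
    · exact fun h => h (Fin.last q) le_rfl
    · intro h i hi
      rw [show i = Fin.last q from Fin.ext (by simp; omega), h]
  rw [← h1, ← covDs_coeff_eq_sum_chain hB ha x q (by omega) (fun _ => c) _ (by
    intro i hi
    simp only [indexPair, Finset.mem_filter] at hi
    exact hi.2.1), multi_indexPair _ (by omega)]

/-! ### Matching the ranges of summation -/

theorem available_indexPair (k : ℕ) : available (indexPair (q + 1) q) q k
    = Finset.univ.filter fun i : Fin (2 * (q + 1)) => 2 * (q - k) ≤ (i : ℕ) := by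
  ext i
  have := i.2
  simp only [available, indexPair, Finset.mem_union, Finset.mem_filter, Finset.mem_univ, true_and]
  omega

theorem card_available_indexPair {k : ℕ} (hk : k ≤ q) :
    (available (indexPair (q + 1) q) q k).card = 2 * (k + 1) := by
  have : available (indexPair (q + 1) q) q k
      = Finset.Ici (⟨2 * (q - k), by omega⟩ : Fin (2 * (q + 1))) := by
    rw [available_indexPair]
    ext i
    simp [Fin.le_def]
  rw [this, Fin.card_Ici]
  simp only
  omega

/-- The sets removed up to step `k` are disjoint and lie among the `2 * (k + 1)` labels issued by
then. -/
theorem sum_card_le_of_admissible {τ : Fin q → Finset (Fin (2 * (q + 1)))}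
    (hτ : τ ∈ admissible (indexPair (q + 1) q) q) (k : Fin q) :
    ∑ j ∈ Finset.Iic k, (τ j).card ≤ 2 * ((k : ℕ) + 1) := by
  rw [mem_admissible] at hτ
  have hd : ∀ i j, i < j → Disjoint (τ i) (τ j) := by
    intro i j hij
    have := (Finset.subset_sdiff.1 (hτ j)).2
    exact (this.mono_right (Finset.subset_biUnion_of_mem τ (Finset.mem_Iio.2 hij))).symm
  rw [← Finset.card_biUnion fun i _ j _ hij =>
    (lt_or_gt_of_ne hij).elim (hd i j) fun h => (hd j i h).symm,
    ← card_available_indexPair (by omega : (k : ℕ) ≤ q)]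
  refine Finset.card_le_card (Finset.biUnion_subset.2 fun j hj i hi => ?_)
  have h1 := (Finset.mem_sdiff.1 (hτ j hi)).1
  have h2 : (j : ℕ) ≤ k := Fin.le_def.1 (Finset.mem_Iic.1 hj)
  rw [available_indexPair] at h1 ⊢
  simp only [Finset.mem_filter, Finset.mem_univ, true_and] at h1 ⊢
  omega

theorem sum_Iic_eq (f : Fin q → ℕ) (k : Fin q) :
    ∑ j ∈ Finset.Iic k, f j = (∑ j ∈ Finset.Iio k, f j) + f k := by
  rw [← Finset.Iio_insert, Finset.sum_insert (by simp), add_comm]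

/-- The bounds on `p` hold automatically for the cardinalities of an admissible family, so the
double sum merely sorts these families by cardinality. -/
theorem sum_pRange_sigmaRange {M : Type*} [AddCommMonoid M]
    (f : (Fin q → ℕ) → (Fin q → Finset (Fin (2 * (q + 1)))) → M) :
    ∑ p ∈ pRange (q + 1), ∑ σ ∈ sigmaRange (q + 1) p, f p σ
      = ∑ τ ∈ admissible (indexPair (q + 1) q) q, f (fun k => (τ k).card) τ := by
  have hmaps : ∀ τ ∈ admissible (indexPair (q + 1) q) q,
      (fun k => (τ k).card) ∈ pRange (q + 1) := by
    intro τ hτ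
    have h : ∀ k : Fin q, (∑ j ∈ Finset.Iio k, (τ j).card) + (τ k).card ≤ 2 * ((k : ℕ) + 1) :=
      fun k => (sum_Iic_eq _ k).symm.trans_le (sum_card_le_of_admissible hτ k)
    rw [pRange, Finset.mem_filter, Fintype.mem_piFinset]
    refine ⟨fun k => ?_, h⟩
    have := h k
    rw [Finset.mem_range]
    omega
  rw [← Finset.sum_fiberwise_of_maps_to hmaps]
  refine Finset.sum_congr rfl fun p _ => ?_
  have hset : sigmaRange (q + 1) p
      = (admissible (indexPair (q + 1) q) q).filter fun τ => (fun k => (τ k).card) = p := by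
    ext τ
    simp only [sigmaRange, Finset.mem_filter, Finset.mem_univ, true_and, mem_admissible,
      available_indexPair, Nat.add_sub_add_right, forall_and, funext_iff]
    exact and_comm
  rw [hset]
  refine Finset.sum_congr rfl fun τ hτ => ?_
  rw [(Finset.mem_filter.1 hτ).2]

theorem stepWeight_eq_weight (τ : Fin q → Finset (Fin (2 * (q + 1)))) (k : Fin q) :
    stepWeight (indexPair (q + 1) q) q τ k = weight (q + 1) (fun k => (τ k).card) k := by
  simp only [stepWeight, weight, card_indexPair (Nat.lt_succ_self q)]
  congr 1
  omega

end Main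
end HeatDiag

open HeatDiag in
theorem theorem2 {𝕜 : Type*} [RCLike 𝕜] {d N : ℕ}
    (B : Fin d → EuclideanSpace ℝ (Fin d) → Matrix (Fin N) (Fin N) 𝕜)
    (hB : ∀ μ, ContDiff ℝ ∞ (B μ))
    (a : ℕ → EuclideanSpace ℝ (Fin d) → EuclideanSpace ℝ (Fin d) → Matrix (Fin N) (Fin N) 𝕜)
    (ha : IsSeeleyDeWitt B a)
    (x : EuclideanSpace ℝ (Fin d)) :
    (∀ n : ℕ, 1 ≤ n →
      a n x x =
        ∑ ν : Fin n → Fin d, ∑ p ∈ pRange n, ∑ σ ∈ sigmaRange n p,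
          (List.ofFn fun k : Fin (n - 1) =>
            (weight n p k : ℝ)⁻¹ • SigmaHat B x (weight n p k) (doubled ν) (σ k)).prod *
          ((n : ℝ)⁻¹ • SigmaHat B x 0 (doubled ν) (Finset.univ \ Finset.univ.biUnion σ))) ∧
    (∀ (m l : ℕ) (μ : Fin m → Fin d) (J : Finset (Fin m)),
      SigmaHat B x l μ J =
        ∑ k ∈ Finset.range (J.card + 1), ∑ σ ∈ orderedPartitions J k,
          ((List.ofFn fun i : Fin k =>
            Shat B x (multi μ (σ i)) (l + cumCard σ i)).reverse).prod) ∧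
    (∀ (l : ℕ) (L : List (Fin d)) (ν : Fin d), 1 ≤ l →
      Shat B x (L ++ [ν]) l =
        (l : ℝ)⁻¹ • ∑ k : Fin L.length,
          nablas B (L.eraseIdx k) (fieldStrength B (L.get k) ν) x) := by
  refine ⟨fun n hn => ?_, fun m l μ J => SigmaHat_eq B x l μ J, fun l L ν _ => ?_⟩
  · obtain ⟨q, rfl⟩ : ∃ q, n = q + 1 := ⟨n - 1, by omega⟩
    rw [coeff_diagonal_eq_sum_chain hB ha, Finset.smul_sum]
    refine Finset.sum_congr rfl fun ν _ => ?_
    -- `Fin (q + 1 - 1)` reduces to `Fin q`, so the two index types agree definitionally.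
    refine Eq.trans ?_ (sum_pRange_sigmaRange _).symm
    rw [Finset.smul_sum]
    refine Finset.sum_congr rfl fun τ _ => ?_
    -- At the end all `2n` labels have been issued; those never removed go to the final `Σ̂_0`.
    have hrest : available (indexPair (q + 1) q) q q = Finset.univ := by
      rw [available_indexPair]
      simp
    rw [chain, mul_smul_comm, hrest]
    simp only [stepWeight_eq_weight]
    rfl
  -- At `y = x` the radial remainder vanishes.
  · rw [Shat_eq, vertex_append hB]
    simp
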